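/- Let $\mathcal{E}$ be an elementary topos with a chosen terminal object $1$ and chosen binary products. Let $(\Sigma,E)$ be a presentation of a variety: a set $\Sigma$ of operation symbols of finite arity and a set $E$ of equations between $\Sigma$-terms. Let $(Q,\otimes,k,\bigvee)$ be an internal commutative quantale in $\mathcal{E}$, i.e. an internal commutative monoid with an internal partial order for which every subset has a join $\bigvee:\Omega^Q\to Q$, such that in the internal language $a\otimes\bigvee B=\bigvee\{a\otimes b\mid b\in B\}$ and $(\bigvee A)\otimes b=\bigvee\{a\otimes b\mid a\in A\}$. Let $\mathbf{Rel}_{(\Sigma,E)}(Q)$ be the following symmetric monoidal category, described in the internal language of $\mathcal{E}$. Its objects are the $(\Sigma,E)$-algebras in $\mathcal{E}$. A morphism $A\to B$ is an algebraic $Q$-relation, i.e. a morphism $R:A\times B\to Q$ of $\mathcal{E}$ such that, for every $\sigma\in\Sigma$ of arity $n$, $$R(a_1,b_1)\otimes\dots\otimes R(a_n,b_n)\le R(\sigma(a_1,\dots,a_n),\sigma(b_1,\dots,b_n)),$$ the left-hand side being $k$ for $n=0$. Identities and composition are $$1_A(a_1,a_2)=\bigvee\{k\mid a_1=a_2\},\qquad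 (S\circ R)(a,c)=\bigvee_b R(a,b)\otimes S(b,c).$$ The tensor product is the product of algebras on objects and $(R\otimes R')((a,a'),(b,b'))=R(a,b)\otimes R'(a',b')$ on morphisms, and the unit is the terminal algebra. The graph of a homomorphism $f:A\to B$ is $f_\circ(a,b)=\bigvee\{k\mid f(a)=b\}$, and the converse of $R$ is $R^\circ(b,a)=R(a,b)$. The associator, unitors and symmetry are the graphs of those of the finite product structure on algebras. Then $\mathbf{Rel}_{(\Sigma,E)}(Q)$ is a hypergraph category, in which the cocommutative comonoid structure on each object $A$ is given by the graphs $$\epsilon_A=(!:A\to 1)_\circ,\qquad \delta_A=(\langle 1_A,1_A\rangle:A\to A\times A)_\circ$$ and the commutative monoid structure by their converses $\eta_A=(\epsilon_A)^\circ$, $\mu_A=(\delta_A)^\circ$. That is, for every object $A$ these form a commutative monoid and a cocommutative comonoid satisfying the Frobenius equations $(\mu\otimes 1)\circ(1\otimes\delta)=\delta\circ\mu=(1\otimes\mu)\circ(\delta\otimes 1)$ and the special equation $\mu\circ\delta=1_A$; and the structures are coherent with the tensor product: up to the canonical coherence isomorphisms, $\delta_{A\otimes B}$, $\epsilon_{A\otimes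 B}$, $\mu_{A\otimes B}$, $\eta_{A\otimes B}$ are the tensor products of the corresponding structures on $A$ and $B$. -/

import Mathlib

open CategoryTheory MonoidalCategory CartesianMonoidalCategory Limits

universe w v u

set_option linter.unusedSectionVars false

/-! ## The internal language of an elementary topos

Throughout, an elementary topos is a category `C` with finite limits (with a choice of terminal
object `𝟙_ C` and of binary products `X ⊗ Y`), exponentials and a subobject classifier.
A formula in context `X` is a morphism `X ⟶ Ω C`, a term of type `A` in context `X` is a morphism
`X ⟶ A`. -/

namespace ToposLogic

noncomputable section

open HasSubobjectClassifier MonoidalClosed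

variable {C : Type u} [Category.{v} C] [CartesianMonoidalCategory C] [HasFiniteLimits C]
  [MonoidalClosed C] [HasSubobjectClassifier C]

/-- The formula `⊤` in context `X`. -/
def tt (X : C) : X ⟶ Ω C := Subobject.Classifier.χ₀ _ X ≫ truth C

/-- The formula `p` is valid (in its context). -/
def Holds {X : C} (p : X ⟶ Ω C) : Prop := p = tt X

/-- The formula `a = b`. -/
def eqP {X A : C} (a b : X ⟶ A) : X ⟶ Ω C := lift a b ≫ χ (lift (𝟙 A) (𝟙 A))

/-- The formula `p ∧ q`. -/
def andP {X : C} (p q : X ⟶ Ω C) : X ⟶ Ω C := lift p q ≫ χ (lift (truth C) (truth C))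

/-- The formula `p ⇒ q`, which is `p ∧ q = p`. -/
def impP {X : C} (p q : X ⟶ Ω C) : X ⟶ Ω C := eqP (andP p q) p

/-- The formula `∀ y : Y, p (y, x)`, which is `{y | p (y, x)} = {y | ⊤}`. -/
def allP {X Y : C} (p : Y ⊗ X ⟶ Ω C) : X ⟶ Ω C := eqP (curry p) (curry (tt (Y ⊗ X)))

/-- The formula `∃ y : Y, p (y, x)`, which is `∀ ω : Ω, (∀ y : Y, p (y, x) ⇒ ω) ⇒ ω`. -/
def exP {X Y : C} (p : Y ⊗ X ⟶ Ω C) : X ⟶ Ω C :=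
  allP (Y := Ω C) (impP
    (allP (Y := Y) (impP (Y ◁ snd (Ω C) X ≫ p) (snd Y (Ω C ⊗ X) ≫ fst (Ω C) X)))
    (fst (Ω C) X))

/-- The power object `Ω ^ A`. -/
abbrev Pow (A : C) : C := (ihom A).obj (Ω C)

/-- The formula `a ∈ S`. -/
def memP {X A : C} (a : X ⟶ A) (S : X ⟶ Pow A) : X ⟶ Ω C := lift a S ≫ (ihom.ev A).app (Ω C)

/-- The term `{t (y, x) | y : Y, p (y, x)}` of type `Ω ^ A`, in context `X`:
the set of those `a : A` for which `∃ y : Y, p (y, x) ∧ a = t (y, x)`. -/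
def imageSet {X Y A : C} (p : Y ⊗ X ⟶ Ω C) (t : Y ⊗ X ⟶ A) : X ⟶ Pow A :=
  curry (exP (Y := Y) (andP (Y ◁ snd A X ≫ p)
    (eqP (snd Y (A ⊗ X) ≫ fst A X) (Y ◁ snd A X ≫ t))))

/-! ### Kripke–Joyal semantics -/

lemma comp_tt {X Y : C} (f : X ⟶ Y) : f ≫ tt Y = tt X := by
  unfold tt
  rw [← Category.assoc]
  congr 1
  exact Subsingleton.elim _ _

lemma Holds.comp {X Y : C} {p : Y ⟶ Ω C} (h : Holds p) (f : X ⟶ Y) : Holds (f ≫ p) := by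
  unfold Holds at *; rw [h, comp_tt]

lemma holds_tt (X : C) : Holds (tt X) := rfl

lemma holds_χ {U X Y : C} (m : U ⟶ X) [Mono m] (f : Y ⟶ X) :
    Holds (f ≫ χ m) ↔ ∃ g : Y ⟶ U, g ≫ m = f := by
  constructor
  · intro h
    exact ⟨(isPullback_χ m).lift f (Subobject.Classifier.χ₀ _ Y) h,
      (isPullback_χ m).lift_fst _ _ _⟩
  · rintro ⟨g, rfl⟩
    unfold Holds
    rw [Category.assoc, HasSubobjectClassifier.comm, ← Category.assoc]
    unfold tt
    congr 1
    exact Subsingleton.elim _ _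

lemma holds_eqP {X A : C} (a b : X ⟶ A) : Holds (eqP a b) ↔ a = b := by
  unfold eqP
  rw [holds_χ]
  constructor
  · rintro ⟨g, hg⟩
    have h1 := congrArg (· ≫ fst A A) hg
    have h2 := congrArg (· ≫ snd A A) hg
    simp at h1 h2
    rw [← h1, ← h2]
  · rintro rfl
    exact ⟨a, by ext <;> simp⟩

lemma holds_andP {X : C} (p q : X ⟶ Ω C) : Holds (andP p q) ↔ Holds p ∧ Holds q := by
  unfold andP
  rw [holds_χ]
  constructor
  · rintro ⟨g, hg⟩
    have h1 := congrArg (· ≫ fst _ _) hg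
    have h2 := congrArg (· ≫ snd _ _) hg
    simp at h1 h2
    have e : g = Subobject.Classifier.χ₀ _ X := Subsingleton.elim _ _
    rw [e] at h1 h2
    exact ⟨h1.symm, h2.symm⟩
  · rintro ⟨h1, h2⟩
    refine ⟨Subobject.Classifier.χ₀ _ X, ?_⟩
    ext
    · rw [h1]; simp [tt]
    · rw [h2]; simp [tt]

lemma formula_ext {X : C} {p q : X ⟶ Ω C}
    (h : ∀ {Y : C} (f : Y ⟶ X), Holds (f ≫ p) ↔ Holds (f ≫ q)) : p = q := by
  have key : ∀ (r : X ⟶ Ω C), r = χ (pullback.fst r (truth C)) := by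
    intro r
    apply HasSubobjectClassifier.unique
    have := IsPullback.of_hasPullback r (truth C)
    convert this using 1
    exact Subsingleton.elim _ _
  have hp : Holds (pullback.fst p (truth C) ≫ q) := by
    rw [← h]
    unfold Holds
    rw [pullback.condition]
    unfold tt
    congr 1
    exact Subsingleton.elim _ _
  rw [key p]
  symm
  apply HasSubobjectClassifier.unique
  refine ⟨⟨hp⟩, ⟨PullbackCone.IsLimit.mk _ ?_ ?_ ?_ ?_⟩⟩
  · intro s
    refine pullback.lift s.fst s.snd ?_
    have : Holds (s.fst ≫ p) := by
      rw [h]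
      unfold Holds
      rw [s.condition]
      unfold tt
      congr 1
      exact Subsingleton.elim _ _
    rw [this]
    unfold tt
    congr 1
    exact Subsingleton.elim _ _
  · intro s; exact pullback.lift_fst _ _ _
  · intro s; exact Subsingleton.elim _ _
  · intro s m h1 h2
    rw [← cancel_mono (pullback.fst p (truth C))]
    rw [h1]; exact (pullback.lift_fst _ _ _).symm

lemma comp_eqP {X Y A : C} (f : Y ⟶ X) (a b : X ⟶ A) : f ≫ eqP a b = eqP (f ≫ a) (f ≫ b) := by
  simp [eqP, ← Category.assoc, comp_lift]

lemma comp_andP {X Y : C} (f : Y ⟶ X) (p q : X ⟶ Ω C) :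
    f ≫ andP p q = andP (f ≫ p) (f ≫ q) := by
  simp [andP, ← Category.assoc, comp_lift]

lemma comp_impP {X Y : C} (f : Y ⟶ X) (p q : X ⟶ Ω C) :
    f ≫ impP p q = impP (f ≫ p) (f ≫ q) := by
  simp only [impP, comp_eqP, comp_andP]

lemma comp_allP {X X' Y : C} (f : X' ⟶ X) (p : Y ⊗ X ⟶ Ω C) :
    f ≫ allP p = allP (Y ◁ f ≫ p) := by
  simp only [allP, comp_eqP, ← curry_natural_left, comp_tt]

lemma holds_impP {X : C} (p q : X ⟶ Ω C) :
    Holds (impP p q) ↔ ∀ {Y : C} (f : Y ⟶ X), Holds (f ≫ p) → Holds (f ≫ q) := by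
  unfold impP
  rw [holds_eqP]
  constructor
  · intro h Y f hp
    rw [← h, comp_andP, holds_andP] at hp
    exact hp.2
  · intro h
    apply formula_ext
    intro Y f
    rw [comp_andP, holds_andP]
    exact ⟨fun h => h.1, fun hp => ⟨hp, h f hp⟩⟩

lemma holds_allP {X Y : C} (p : Y ⊗ X ⟶ Ω C) :
    Holds (allP p) ↔ ∀ {Z : C} (f : Z ⟶ X) (y : Z ⟶ Y), Holds (lift y f ≫ p) := by
  unfold allP
  rw [holds_eqP]
  constructor
  · intro h Z f y
    rw [curry_injective h]
    exact (holds_tt _).comp _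
  · intro h
    congr 1
    have := h (snd Y X) (fst Y X)
    simpa [Holds] using this

lemma holds_exP_intro {X Y : C} (p : Y ⊗ X ⟶ Ω C) (y : X ⟶ Y) (h : Holds (lift y (𝟙 X) ≫ p)) :
    Holds (exP p) := by
  unfold exP
  rw [holds_allP]
  intro Z f o
  rw [comp_impP, holds_impP]
  intro W g hg
  rw [comp_allP, comp_allP, holds_allP] at hg
  have := hg (𝟙 W) (g ≫ f ≫ y)
  simp only [comp_impP, holds_impP] at this
  have := this (𝟙 W)
  simp only [Category.id_comp] at this
  have h2 := h.comp (g ≫ f)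
  have e1 : lift (g ≫ f ≫ y) (𝟙 W) ≫ Y ◁ g ≫ Y ◁ lift o f ≫ Y ◁ snd (Ω C) X ≫ p
    = (g ≫ f) ≫ lift y (𝟙 X) ≫ p := by
    simp only [← Category.assoc]
    congr 1
    ext <;> simp
  have e2 : lift (g ≫ f ≫ y) (𝟙 W) ≫ Y ◁ g ≫ Y ◁ lift o f ≫ snd Y (Ω C ⊗ X) ≫ fst (Ω C) X
    = g ≫ o := by simp
  rw [e1, e2] at this
  simpa using this h2

lemma holds_exP_elim {X Y : C} (p : Y ⊗ X ⟶ Ω C) (h : Holds (exP p)) (r : X ⟶ Ω C)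
    (hr : ∀ {Z : C} (f : Z ⟶ X) (y : Z ⟶ Y), Holds (lift y f ≫ p) → Holds (f ≫ r)) :
    Holds r := by
  unfold exP at h
  rw [holds_allP] at h
  have h1 := h (𝟙 X) r
  rw [comp_impP, holds_impP] at h1
  have h2 := h1 (𝟙 X)
  simp only [Category.id_comp, lift_fst] at h2
  apply h2
  rw [comp_allP, holds_allP]
  intro Z f y
  simp only [comp_impP, holds_impP]
  intro W g hg
  have e1 : g ≫ lift y f ≫ Y ◁ lift r (𝟙 X) ≫ Y ◁ snd (Ω C) X ≫ p
    = lift (g ≫ y) (g ≫ f) ≫ p := by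
    simp only [← Category.assoc]
    congr 1
    ext <;> simp
  rw [e1] at hg
  simpa using hr _ _ hg

lemma comp_exP {X X' Y : C} (f : X' ⟶ X) (p : Y ⊗ X ⟶ Ω C) :
    f ≫ exP p = exP (Y ◁ f ≫ p) := by
  unfold exP
  rw [comp_allP, comp_impP, comp_allP, comp_impP]
  congr 2
  · congr 2
    · simp only [← Category.assoc]
      congr 1
      ext <;> simp
    · simp
  · simp

lemma holds_memP_curry {X Z A : C} (p : A ⊗ X ⟶ Ω C) (f : Z ⟶ X) (a : Z ⟶ A) :
    Holds (memP a (f ≫ curry p)) ↔ Holds (lift a f ≫ p) := by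
  unfold memP
  have : lift a (f ≫ curry p) ≫ (ihom.ev A).app (Ω C) = lift a f ≫ p := by
    have : lift a (f ≫ curry p) = lift a f ≫ A ◁ curry p := by ext <;> simp
    rw [this, Category.assoc]
    congr 1
    exact whiskerLeft_curry_ihom_ev_app _ _ _
  rw [this]

lemma mem_imageSet {X Y Z A : C} (p : Y ⊗ X ⟶ Ω C) (t : Y ⊗ X ⟶ A) (f : Z ⟶ X) (y : Z ⟶ Y)
    (h : Holds (lift y f ≫ p)) : Holds (memP (lift y f ≫ t) (f ≫ imageSet p t)) := by
  unfold imageSet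
  rw [holds_memP_curry, comp_exP]
  refine holds_exP_intro _ y ?_
  have e (B : C) (s : Y ⊗ X ⟶ B) :
      lift y (𝟙 Z) ≫ Y ◁ lift (lift y f ≫ t) f ≫ Y ◁ snd A X ≫ s = lift y f ≫ s := by
    simp only [← Category.assoc]
    congr 1
    ext <;> simp
  rw [comp_andP, comp_andP, holds_andP, comp_eqP, comp_eqP, holds_eqP]
  refine ⟨by rwa [e], ?_⟩
  rw [e]
  simp

lemma imageSet_elim {X Y Z A : C} (p : Y ⊗ X ⟶ Ω C) (t : Y ⊗ X ⟶ A) (f : Z ⟶ X) (a : Z ⟶ A)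
    (h : Holds (memP a (f ≫ imageSet p t))) (r : Z ⟶ Ω C)
    (hr : ∀ {W : C} (g : W ⟶ Z) (y : W ⟶ Y), Holds (lift y (g ≫ f) ≫ p) →
      g ≫ a = lift y (g ≫ f) ≫ t → Holds (g ≫ r)) : Holds r := by
  unfold imageSet at h
  rw [holds_memP_curry, comp_exP] at h
  refine holds_exP_elim _ h r ?_
  intro W g y hW
  have e (B : C) (s : Y ⊗ X ⟶ B) :
      lift y g ≫ Y ◁ lift a f ≫ Y ◁ snd A X ≫ s = lift y (g ≫ f) ≫ s := by
    simp only [← Category.assoc]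
    congr 1
    ext <;> simp
  rw [comp_andP, comp_andP, holds_andP, comp_eqP, comp_eqP, holds_eqP, e, e] at hW
  refine hr g y hW.1 ?_
  rw [← hW.2]
  simp

end

end ToposLogic

/-! ## Internal quantales -/

open ToposLogic

/-- An internal quantale in the topos `C`: an object carrying a monoid structure, a partial order
(the formula `le`), and a join operation `sup : Ω ^ Q ⟶ Q` sending every subset to its least upper
bound, such that multiplication distributes over joins on both sides. The axioms are expressed in
the internal language of `C`, by means of generalized elements. -/
structure InternalQuantale (C : Type u) [Category.{v} C] [CartesianMonoidalCategory C]
    [HasFiniteLimits C] [MonoidalClosed C] [HasSubobjectClassifier C] where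
  /-- The underlying object. -/
  carrier : C
  /-- The monoid structure. -/
  [mon : MonObj carrier]
  /-- The order, as a formula with two free variables. -/
  le : carrier ⊗ carrier ⟶ HasSubobjectClassifier.Ω C
  /-- The join operation. -/
  sup : Pow carrier ⟶ carrier
  le_refl : ∀ {X : C} (a : X ⟶ carrier), Holds (lift a a ≫ le)
  le_trans : ∀ {X : C} (a b c : X ⟶ carrier),
    Holds (lift a b ≫ le) → Holds (lift b c ≫ le) → Holds (lift a c ≫ le)
  le_antisymm : ∀ {X : C} (a b : X ⟶ carrier),
    Holds (lift a b ≫ le) → Holds (lift b a ≫ le) → a = b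
  /-- `⋁ S` is an upper bound of `S`. -/
  le_sup : ∀ {X : C} (S : X ⟶ Pow carrier) (b : X ⟶ carrier),
    Holds (memP b S) → Holds (lift b (S ≫ sup) ≫ le)
  /-- `⋁ S` is below every upper bound of `S`. -/
  sup_le : ∀ {X : C} (S : X ⟶ Pow carrier) (c : X ⟶ carrier),
    (∀ {Y : C} (f : Y ⟶ X) (b : Y ⟶ carrier), Holds (memP b (f ≫ S)) →
      Holds (lift b (f ≫ c) ≫ le)) → Holds (lift (S ≫ sup) c ≫ le)
  /-- `a ⊗ ⋁ B = ⋁ {a ⊗ b | b ∈ B}`. -/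
  mul_sup : ∀ {X : C} (a : X ⟶ carrier) (B : X ⟶ Pow carrier),
    lift a (B ≫ sup) ≫ MonObj.mul =
      imageSet (Y := carrier) (memP (fst _ _) (snd _ _ ≫ B))
        (lift (snd _ _ ≫ a) (fst _ _) ≫ MonObj.mul) ≫ sup
  /-- `(⋁ A) ⊗ b = ⋁ {a ⊗ b | a ∈ A}`. -/
  sup_mul : ∀ {X : C} (A : X ⟶ Pow carrier) (b : X ⟶ carrier),
    lift (A ≫ sup) b ≫ MonObj.mul =
      imageSet (Y := carrier) (memP (fst _ _) (snd _ _ ≫ A))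
        (lift (fst _ _) (snd _ _ ≫ b) ≫ MonObj.mul) ≫ sup

attribute [instance] InternalQuantale.mon

namespace InternalQuantale

noncomputable section

open scoped MonObj

variable {C : Type u} [Category.{v} C] [CartesianMonoidalCategory C] [HasFiniteLimits C]
  [MonoidalClosed C] [HasSubobjectClassifier C] (Q : InternalQuantale C)

/-- The order on generalized elements of `Q`. -/
def Le {X : C} (a b : X ⟶ Q.carrier) : Prop := Holds (lift a b ≫ Q.le)

/-- The term `⋁ {t (y, x) | y : Y, p (y, x)}` of type `Q`, in context `X`. -/
def join {X Y : C} (p : Y ⊗ X ⟶ HasSubobjectClassifier.Ω C) (t : Y ⊗ X ⟶ Q.carrier) :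
    X ⟶ Q.carrier := imageSet p t ≫ Q.sup

variable {Q}

lemma Le.refl {X : C} (a : X ⟶ Q.carrier) : Q.Le a a := Q.le_refl a

lemma Le.trans {X : C} {a b c : X ⟶ Q.carrier} (h : Q.Le a b) (h' : Q.Le b c) : Q.Le a c :=
  Q.le_trans a b c h h'

lemma Le.comp {X Y : C} {a b : X ⟶ Q.carrier} (h : Q.Le a b) (f : Y ⟶ X) :
    Q.Le (f ≫ a) (f ≫ b) := by
  have := Holds.comp h f
  rwa [← Category.assoc, comp_lift] at this

lemma eq_of_le_iff {X : C} {a b : X ⟶ Q.carrier} (h : ∀ c, Q.Le a c ↔ Q.Le b c) : a = b :=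
  Q.le_antisymm a b ((h b).2 (Le.refl b)) ((h a).1 (Le.refl a))

lemma comp_mul' {X Y : C} (f : Y ⟶ X) (a b : X ⟶ Q.carrier) :
    f ≫ (a * b) = (f ≫ a) * (f ≫ b) := by
  rw [Hom.mul_def, Hom.mul_def, ← Category.assoc, comp_lift]

lemma comp_one' {X Y : C} (f : Y ⟶ X) : f ≫ (1 : X ⟶ Q.carrier) = 1 := by
  simp [Hom.one_def]

lemma mul_sup_le {X : C} (S : X ⟶ Pow Q.carrier) (d c : X ⟶ Q.carrier) :
    Q.Le (d * (S ≫ Q.sup)) c ↔ ∀ {Z : C} (f : Z ⟶ X) (b : Z ⟶ Q.carrier),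
      Holds (memP b (f ≫ S)) → Q.Le ((f ≫ d) * b) (f ≫ c) := by
  have e0 {Z : C} (f : Z ⟶ X) (b : Z ⟶ Q.carrier) :
    lift b f ≫ memP (fst Q.carrier X) (snd Q.carrier X ≫ S) = memP b (f ≫ S) := by
    unfold memP
    rw [← Category.assoc, comp_lift]
    simp
  have e1 {Z : C} (f : Z ⟶ X) (b : Z ⟶ Q.carrier) :
    lift b f ≫ lift (snd Q.carrier X ≫ d) (fst Q.carrier X) ≫ μ = (f ≫ d) * b := by
    rw [← Category.assoc, comp_lift]
    simp [Hom.mul_def]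
  rw [Hom.mul_def, Q.mul_sup]
  constructor
  · intro h Z f b hb
    refine Le.trans ?_ (h.comp f)
    have := mem_imageSet (memP (fst Q.carrier X) (snd Q.carrier X ≫ S))
      (lift (snd Q.carrier X ≫ d) (fst Q.carrier X) ≫ μ) f b (by rwa [e0])
    have := Q.le_sup _ _ this
    rw [e1] at this
    simpa [Le] using this
  · intro h
    refine Q.sup_le _ _ ?_
    intro Y f b hb
    refine imageSet_elim _ _ _ _ hb _ ?_
    intro W g y h1 h2
    rw [e0] at h1
    rw [e1] at h2
    have := h _ _ h1
    rw [← h2] at this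
    rw [← Category.assoc, comp_lift]
    simpa [Le] using this

/-- The subset of elements below `b`. -/
def down {X : C} (b : X ⟶ Q.carrier) : X ⟶ Pow Q.carrier :=
  MonoidalClosed.curry (lift (fst Q.carrier X) (snd Q.carrier X ≫ b) ≫ Q.le)

lemma mem_down {X Z : C} (b : X ⟶ Q.carrier) (f : Z ⟶ X) (a : Z ⟶ Q.carrier) :
    Holds (memP a (f ≫ down b)) ↔ Q.Le a (f ≫ b) := by
  unfold down
  rw [holds_memP_curry, ← Category.assoc, comp_lift]
  simp [Le]

lemma sup_down {X : C} (b : X ⟶ Q.carrier) : down b ≫ Q.sup = b := by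
  apply Q.le_antisymm
  · apply Q.sup_le
    intro Y f c hc
    rwa [mem_down] at hc
  · apply Q.le_sup
    have := (mem_down b (𝟙 X) b).2 (by simpa using Le.refl b)
    simpa using this

lemma mul_le_mul_left' {X : C} {a b : X ⟶ Q.carrier} (h : Q.Le a b) (d : X ⟶ Q.carrier) :
    Q.Le (d * a) (d * b) := by
  have := (mul_sup_le (down b) d (d * b)).1 (by rw [sup_down]; exact Le.refl _) (𝟙 X) a
    ((mem_down b (𝟙 X) a).2 (by simpa using h))
  simpa using this

lemma mul_join_le {X Y Z : C} (p : Y ⊗ X ⟶ HasSubobjectClassifier.Ω C) (t : Y ⊗ X ⟶ Q.carrier)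
    (f : Z ⟶ X) (d c : Z ⟶ Q.carrier) :
    Q.Le (d * (f ≫ Q.join p t)) c ↔ ∀ {W : C} (g : W ⟶ Z) (y : W ⟶ Y),
      Holds (lift y (g ≫ f) ≫ p) → Q.Le ((g ≫ d) * (lift y (g ≫ f) ≫ t)) (g ≫ c) := by
  unfold join
  rw [← Category.assoc, mul_sup_le]
  constructor
  · intro h W g y hy
    have := mem_imageSet p t (g ≫ f) y hy
    exact h g _ (by simpa using this)
  · intro h W g b hb
    have hb' : Holds (memP b ((g ≫ f) ≫ imageSet p t)) := by simpa using hb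
    refine imageSet_elim _ _ _ _ hb' _ ?_
    intro W' g' y h1 h2
    have := h (g' ≫ g) y (by simpa using h1)
    rw [← Category.assoc, comp_lift, comp_mul', h2]
    simpa [Le] using this

end

end InternalQuantale

/-! ## Relations with truth values in an internal quantale -/

namespace QRel

noncomputable section

open InternalQuantale

open scoped MonObj

variable {C : Type u} [Category.{v} C] [CartesianMonoidalCategory C]
  [HasFiniteLimits C] [MonoidalClosed C] [HasSubobjectClassifier C] {Q : InternalQuantale C}

/-- The truth value `R (a, b)`. -/
def app {A B X : C} (R : A ⊗ B ⟶ Q.carrier) (a : X ⟶ A) (b : X ⟶ B) : X ⟶ Q.carrier :=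
  lift a b ≫ R

variable (Q) in
/-- The graph of `f`: the relation `f_∘ (a, b) = ⋁ {k | f a = b}`. -/
def graph {A B : C} (f : A ⟶ B) : A ⊗ B ⟶ Q.carrier :=
  Q.join (Y := 𝟙_ C) (eqP (snd _ _ ≫ fst A B ≫ f) (snd _ _ ≫ snd A B)) (toUnit _ ≫ η)

/-- The composite relation: `(a, c) ↦ ⋁ {R (a, b) ⊗ S (b, c) | b : B}`. -/
def comp {A B D : C} (R : A ⊗ B ⟶ Q.carrier) (S : B ⊗ D ⟶ Q.carrier) : A ⊗ D ⟶ Q.carrier :=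
  Q.join (Y := B) (tt _)
    (app R (snd _ _ ≫ fst A D) (fst B (A ⊗ D)) * app S (fst B (A ⊗ D)) (snd _ _ ≫ snd A D))

/-- The tensor of relations: `((a, a'), (b, b')) ↦ R (a, b) ⊗ R' (a', b')`. -/
def tensor {A A' B B' : C} (R : A ⊗ B ⟶ Q.carrier) (R' : A' ⊗ B' ⟶ Q.carrier) :
    (A ⊗ A') ⊗ (B ⊗ B') ⟶ Q.carrier :=
  app R (fst _ _ ≫ fst A A') (snd _ _ ≫ fst B B') *
    app R' (fst _ _ ≫ snd A A') (snd _ _ ≫ snd B B')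

/-- The converse relation: `(b, a) ↦ R (a, b)`. -/
def converse {A B : C} (R : A ⊗ B ⟶ Q.carrier) : B ⊗ A ⟶ Q.carrier := app R (snd B A) (fst B A)

lemma ext' {A B : C} {R S : A ⊗ B ⟶ Q.carrier}
    (h : ∀ {X : C} (a : X ⟶ A) (b : X ⟶ B), app R a b = app S a b) : R = S := by
  simpa [app] using h (fst A B) (snd A B)

lemma comp_app {A B X Y : C} (R : A ⊗ B ⟶ Q.carrier) (f : Y ⟶ X) (a : X ⟶ A) (b : X ⟶ B) :
    f ≫ app R a b = app R (f ≫ a) (f ≫ b) := by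
  simp [app, ← Category.assoc, comp_lift]

lemma app_converse {A B X : C} (R : A ⊗ B ⟶ Q.carrier) (a : X ⟶ A) (b : X ⟶ B) :
    app (converse R) b a = app R a b := by
  change lift b a ≫ app R _ _ = _
  rw [comp_app]; simp

lemma app_tensor {A A' B B' X : C} (R : A ⊗ B ⟶ Q.carrier) (R' : A' ⊗ B' ⟶ Q.carrier)
    (a : X ⟶ A ⊗ A') (b : X ⟶ B ⊗ B') :
    app (tensor R R') a b =
      app R (a ≫ fst _ _) (b ≫ fst _ _) * app R' (a ≫ snd _ _) (b ≫ snd _ _) := by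
  change lift a b ≫ (app R _ _ * app R' _ _) = _
  rw [comp_mul', comp_app, comp_app]; simp

lemma mul_graph_le {A B X : C} (f : A ⟶ B) (a : X ⟶ A) (b : X ⟶ B) (d c : X ⟶ Q.carrier) :
    Q.Le (d * app (graph Q f) a b) c ↔ ∀ {Z : C} (g : Z ⟶ X), g ≫ a ≫ f = g ≫ b →
      Q.Le (g ≫ d) (g ≫ c) := by
  unfold graph
  conv_lhs => unfold app
  rw [mul_join_le]
  constructor
  · intro h Z g hg
    have := h g (toUnit _) (by rw [comp_eqP, holds_eqP]; simpa using hg)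
    rw [← Hom.one_def, comp_one', mul_one] at this
    exact this
  · intro h Z g y hg
    rw [← Hom.one_def, comp_one', mul_one]
    apply h
    rw [comp_eqP, holds_eqP] at hg
    simpa using hg

lemma mul_comp_le {A B D X : C} (R : A ⊗ B ⟶ Q.carrier) (S : B ⊗ D ⟶ Q.carrier)
    (a : X ⟶ A) (b : X ⟶ D) (d c : X ⟶ Q.carrier) :
    Q.Le (d * app (comp R S) a b) c ↔ ∀ {Z : C} (g : Z ⟶ X) (y : Z ⟶ B),
      Q.Le ((g ≫ d) * (app R (g ≫ a) y * app S y (g ≫ b))) (g ≫ c) := by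
  unfold comp
  conv_lhs => unfold app
  rw [mul_join_le]
  simp only [comp_mul']
  constructor
  · intro h Z g y
    have := h g y ((holds_tt _).comp _)
    simpa [app, ← Category.assoc, comp_lift] using this
  · intro h Z g y _
    have := h g y
    simpa [app, ← Category.assoc, comp_lift] using this

lemma graph_le {A B X : C} (f : A ⟶ B) (a : X ⟶ A) (b : X ⟶ B) (c : X ⟶ Q.carrier) :
    Q.Le (app (graph Q f) a b) c ↔ ∀ {Z : C} (g : Z ⟶ X), g ≫ a ≫ f = g ≫ b →
      Q.Le 1 (g ≫ c) := by
  have := mul_graph_le f a b 1 c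
  rw [one_mul] at this
  simpa only [comp_one'] using this

lemma comp_le {A B D X : C} (R : A ⊗ B ⟶ Q.carrier) (S : B ⊗ D ⟶ Q.carrier)
    (a : X ⟶ A) (b : X ⟶ D) (c : X ⟶ Q.carrier) :
    Q.Le (app (comp R S) a b) c ↔ ∀ {Z : C} (g : Z ⟶ X) (y : Z ⟶ B),
      Q.Le (app R (g ≫ a) y * app S y (g ≫ b)) (g ≫ c) := by
  have := mul_comp_le R S a b 1 c
  rw [one_mul] at this
  simpa only [comp_one', one_mul] using this

variable [BraidedCategory C] [IsCommMonObj Q.carrier]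

lemma app_graph_comp {A B D X : C} (f : A ⟶ B) (S : B ⊗ D ⟶ Q.carrier)
    (a : X ⟶ A) (b : X ⟶ D) : app (comp (graph Q f) S) a b = app S (a ≫ f) b := by
  apply eq_of_le_iff
  intro c
  rw [comp_le]
  constructor
  · intro h
    have := h (𝟙 X) (a ≫ f)
    rw [mul_comm, mul_graph_le] at this
    simpa using this (𝟙 X)
  · intro h Z g y
    rw [mul_comm, mul_graph_le]
    intro W k hk
    rw [comp_app, ← hk]
    simpa [comp_app] using h.comp (k ≫ g)

lemma app_comp_converse_graph {A B D X : C} (f : D ⟶ B) (R : A ⊗ B ⟶ Q.carrier)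
    (a : X ⟶ A) (b : X ⟶ D) :
    app (comp R (converse (graph Q f))) a b = app R a (b ≫ f) := by
  apply eq_of_le_iff
  intro c
  rw [comp_le]
  simp only [app_converse]
  constructor
  · intro h
    have := h (𝟙 X) (b ≫ f)
    rw [mul_graph_le] at this
    simpa using this (𝟙 X)
  · intro h Z g y
    rw [mul_graph_le]
    intro W k hk
    rw [comp_app, ← hk]
    simpa [comp_app] using h.comp (k ≫ g)

lemma app_graph_iso {A B X : C} (f : A ≅ B) (a : X ⟶ A) (b : X ⟶ B) :
    app (graph Q f.hom) a b = app (graph Q f.inv) b a := by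
  apply eq_of_le_iff
  intro c
  simp only [graph_le]
  refine ⟨fun h Z g hg => h g ?_, fun h Z g hg => h g ?_⟩
  · rw [← Category.assoc, ← hg]; simp
  · rw [← Category.assoc, ← hg]; simp

lemma graph_iso {A B : C} (f : A ≅ B) : graph Q f.hom = converse (graph Q f.inv) :=
  ext' fun a b => by rw [app_converse, app_graph_iso]

lemma app_comp_graph_iso {A B D X : C} (f : B ≅ D) (R : A ⊗ B ⟶ Q.carrier)
    (a : X ⟶ A) (b : X ⟶ D) : app (comp R (graph Q f.hom)) a b = app R a (b ≫ f.inv) := by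
  rw [graph_iso, app_comp_converse_graph]

lemma id_comp' {A B : C} (R : A ⊗ B ⟶ Q.carrier) : comp (graph Q (𝟙 A)) R = R :=
  ext' fun a b => by rw [app_graph_comp, Category.comp_id]

lemma comp_id' {A B : C} (R : A ⊗ B ⟶ Q.carrier) : comp R (graph Q (𝟙 B)) = R :=
  ext' fun a b => by
    have := app_comp_graph_iso (Iso.refl B) R a b
    simpa using this

lemma comp_assoc {A B D E : C} (R : A ⊗ B ⟶ Q.carrier) (S : B ⊗ D ⟶ Q.carrier)
    (T : D ⊗ E ⟶ Q.carrier) : comp (comp R S) T = comp R (comp S T) := by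
  refine ext' fun {X} a b => eq_of_le_iff fun c => ?_
  rw [comp_le, comp_le]
  constructor
  · intro h Z g y
    rw [mul_comp_le]
    intro W k x
    have := h (k ≫ g) x
    rw [mul_comm, mul_comp_le] at this
    have := this (𝟙 W) (k ≫ y)
    simp only [comp_app, Category.id_comp, Category.assoc] at this ⊢
    rwa [mul_comm, mul_assoc] at this
  · intro h Z g y
    rw [mul_comm, mul_comp_le]
    intro W k x
    have := h (k ≫ g) x
    rw [mul_comp_le] at this
    have := this (𝟙 W) (k ≫ y)
    simp only [comp_app, Category.id_comp, Category.assoc] at this ⊢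
    rwa [mul_comm, mul_assoc]

lemma graph_comp_graph {A B D : C} (f : A ⟶ B) (g : B ⟶ D) :
    comp (graph Q f) (graph Q g) = graph Q (f ≫ g) := by
  refine ext' fun {X} a b => ?_
  rw [app_graph_comp]
  apply eq_of_le_iff
  intro c
  simp only [graph_le, Category.assoc]

lemma tensor_graph {A A' B B' : C} (f : A ⟶ B) (g : A' ⟶ B') :
    tensor (graph Q f) (graph Q g) = graph Q (f ⊗ₘ g) := by
  refine ext' fun {X} a b => eq_of_le_iff fun c => ?_
  rw [app_tensor, mul_graph_le, graph_le]
  simp only [comp_app, graph_le]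
  constructor
  · intro h Z k hk
    have := h k (by simpa using hk =≫ snd _ _) (𝟙 Z) (by simpa using hk =≫ fst _ _)
    simpa using this
  · intro h Z k hk W l hl
    have := h (l ≫ k) (by
      ext
      · simpa using hl
      · simpa using l ≫= hk)
    simpa using this

lemma tensor_comp_tensor {A A' B B' D D' : C} (R : A ⊗ B ⟶ Q.carrier) (R' : A' ⊗ B' ⟶ Q.carrier)
    (S : B ⊗ D ⟶ Q.carrier) (S' : B' ⊗ D' ⟶ Q.carrier) :
    comp (tensor R R') (tensor S S') = tensor (comp R S) (comp R' S') := by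
  refine ext' fun {X} a b => eq_of_le_iff fun c => ?_
  rw [comp_le, app_tensor, mul_comp_le]
  simp only [app_tensor]
  constructor
  · intro h Z g y
    rw [comp_app, mul_comm, mul_comp_le]
    intro W k x
    have := h (k ≫ g) (lift x (k ≫ y))
    simp only [comp_mul', comp_app, Category.assoc, lift_fst, lift_snd] at this ⊢
    convert this using 1
    ac_rfl
  · intro h Z g y
    have := h g (y ≫ snd _ _)
    rw [comp_app, mul_comm, mul_comp_le] at this
    have := this (𝟙 Z) (y ≫ fst _ _)
    simp only [comp_mul', comp_app, Category.assoc, Category.id_comp] at this ⊢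
    convert this using 1
    ac_rfl

lemma comp_prod {X Z : C} (g : Z ⟶ X) {n : ℕ} (t : Fin n → (X ⟶ Q.carrier)) :
    g ≫ ∏ i, t i = ∏ i, g ≫ t i :=
  map_prod (MonoidHom.mk ⟨fun s : X ⟶ Q.carrier => g ≫ s, comp_one' g⟩ (comp_mul' g)) t Finset.univ

lemma mul_prod_graph_le {A B X : C} (f : A ⟶ B) (n : ℕ) (a : Fin n → (X ⟶ A))
    (b : Fin n → (X ⟶ B)) (d c : X ⟶ Q.carrier)
    (h : ∀ {Z : C} (g : Z ⟶ X), (∀ i, g ≫ a i ≫ f = g ≫ b i) → Q.Le (g ≫ d) (g ≫ c)) :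
    Q.Le (d * ∏ i, app (graph Q f) (a i) (b i)) c := by
  induction n generalizing X with
  | zero => simpa using h (𝟙 X) (fun i => i.elim0)
  | succ n ih =>
    rw [Fin.prod_univ_succ, mul_comm (app _ _ _), ← mul_assoc, mul_graph_le]
    intro Z g hg
    rw [comp_mul', comp_prod]
    simp only [comp_app]
    apply ih
    intro W k hk
    have := h (k ≫ g) (fun i => by
      refine Fin.cases ?_ (fun j => ?_) i
      · simpa using k ≫= hg
      · simpa using hk j)
    simpa using this

lemma mul_prod_comp_le {A B D X : C} (R : A ⊗ B ⟶ Q.carrier) (S : B ⊗ D ⟶ Q.carrier) (n : ℕ)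
    (a : Fin n → (X ⟶ A)) (b : Fin n → (X ⟶ D)) (d c : X ⟶ Q.carrier)
    (h : ∀ {Z : C} (g : Z ⟶ X) (y : Fin n → (Z ⟶ B)),
      Q.Le ((g ≫ d) * ∏ i, (app R (g ≫ a i) (y i) * app S (y i) (g ≫ b i))) (g ≫ c)) :
    Q.Le (d * ∏ i, app (comp R S) (a i) (b i)) c := by
  induction n generalizing X with
  | zero => simpa using h (𝟙 X) (fun i => i.elim0)
  | succ n ih =>
    rw [Fin.prod_univ_succ, mul_comm (app _ _ _), ← mul_assoc, mul_comp_le]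
    intro Z g y
    rw [comp_mul', comp_prod, mul_assoc, mul_comm (∏ i, _), ← mul_assoc]
    simp only [comp_app]
    apply ih
    intro W k x
    have := h (k ≫ g) (Fin.cons (k ≫ y) x)
    rw [Fin.prod_univ_succ, ← mul_assoc] at this
    simpa [comp_app, comp_mul'] using this

lemma natural_of_app {A B A' B' : C} (e : A ≅ B) (e' : A' ≅ B') (R : A ⊗ A' ⟶ Q.carrier)
    (S : B ⊗ B' ⟶ Q.carrier)
    (h : ∀ {X : C} (a : X ⟶ A) (b : X ⟶ B'), app R a (b ≫ e'.inv) = app S (a ≫ e.hom) b) :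
    comp R (graph Q e'.hom) = comp (graph Q e.hom) S :=
  ext' fun a b => by rw [app_comp_graph_iso, app_graph_comp, h]

lemma associator_nat {A A' B B' D D' : C} (R : A ⊗ A' ⟶ Q.carrier) (S : B ⊗ B' ⟶ Q.carrier)
    (T : D ⊗ D' ⟶ Q.carrier) :
    comp (tensor (tensor R S) T) (graph Q (α_ A' B' D').hom) =
      comp (graph Q (α_ A B D).hom) (tensor R (tensor S T)) :=
  natural_of_app _ _ _ _ fun a b => by simp [app_tensor, mul_assoc]

lemma leftUnitor_nat {A B : C} (R : A ⊗ B ⟶ Q.carrier) :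
    comp (tensor (graph Q (𝟙 (𝟙_ C))) R) (graph Q (λ_ B).hom) = comp (graph Q (λ_ A).hom) R :=
  natural_of_app _ _ _ _ fun a b => by
    rw [app_tensor]
    apply eq_of_le_iff
    intro c
    rw [mul_comm, mul_graph_le]
    refine ⟨fun h => ?_, fun h Z g _ => ?_⟩
    · simpa [leftUnitor_hom] using h (𝟙 _) (toUnit_unique _ _)
    · simpa [leftUnitor_hom] using h.comp g

lemma rightUnitor_nat {A B : C} (R : A ⊗ B ⟶ Q.carrier) :
    comp (tensor R (graph Q (𝟙 (𝟙_ C)))) (graph Q (ρ_ B).hom) = comp (graph Q (ρ_ A).hom) R :=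
  natural_of_app _ _ _ _ fun a b => by
    rw [app_tensor]
    apply eq_of_le_iff
    intro c
    rw [mul_graph_le]
    refine ⟨fun h => ?_, fun h Z g _ => ?_⟩
    · simpa [rightUnitor_hom] using h (𝟙 _) (toUnit_unique _ _)
    · simpa [rightUnitor_hom] using h.comp g

lemma braiding_nat {A A' B B' : C} (R : A ⊗ A' ⟶ Q.carrier) (S : B ⊗ B' ⟶ Q.carrier) :
    comp (tensor R S) (graph Q (β_ A' B').hom) = comp (graph Q (β_ A B).hom) (tensor S R) :=
  natural_of_app _ _ _ _ fun a b => by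
    rw [app_tensor, app_tensor, mul_comm]
    simp

end

end QRel

/-! ## Varieties and their algebras in a category with finite products -/

/-- An algebraic signature: a set of operation symbols of finite arity. -/
structure AlgSignature where
  /-- The operation symbols. -/
  Op : Type w
  /-- The arities. -/
  arity : Op → ℕ

/-- Terms over a signature in the variables `x₀, …, xₙ₋₁`. -/
inductive AlgSignature.Term (S : AlgSignature.{w}) (n : ℕ) : Type w
  | var : Fin n → AlgSignature.Term S n
  | app (σ : S.Op) : (Fin (S.arity σ) → AlgSignature.Term S n) → AlgSignature.Term S n

/-- A (presentation of a) variety: a signature and a set of equations between terms, each equation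
being stated in a finite context of variables. -/
structure AlgVariety extends AlgSignature.{w} where
  /-- The equations. -/
  eqns : Set (Σ n : ℕ, toAlgSignature.Term n × toAlgSignature.Term n)

namespace AlgVariety

noncomputable section

variable {C : Type u} [Category.{v} C] [CartesianMonoidalCategory C]

/-- The power `A ^ n`. -/
abbrev power (A : C) (n : ℕ) : C := ∏ᶜ fun _ : Fin n => A

/-- The interpretation `A ^ n ⟶ A` of a term. -/
def eval {S : AlgSignature.{w}} {A : C} (op : ∀ σ : S.Op, power A (S.arity σ) ⟶ A) {n : ℕ} :
    S.Term n → (power A n ⟶ A)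
  | .var i => Pi.π (fun _ : Fin n => A) i
  | .app σ ts => Pi.lift (fun j => eval op (ts j)) ≫ op σ

variable (V : AlgVariety.{w}) (C)

/-- Algebras of the variety `V` in `C`. -/
structure Alg where
  /-- The underlying object. -/
  carrier : C
  /-- The operations. -/
  op : ∀ σ : V.Op, power carrier (V.arity σ) ⟶ carrier
  sat : ∀ (n : ℕ) (s t : V.Term n), ⟨n, s, t⟩ ∈ V.eqns → eval op s = eval op t

namespace Alg

variable {V C}

/-- Homomorphisms of algebras. -/
@[ext]
structure Hom (A B : V.Alg C) where
  /-- The underlying morphism. -/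
  hom : A.carrier ⟶ B.carrier
  map_op : ∀ σ : V.Op, A.op σ ≫ hom = Limits.Pi.map (fun _ => hom) ≫ B.op σ

instance : Category (V.Alg C) where
  Hom A B := Hom A B
  id A := ⟨𝟙 _, fun σ => by simp⟩
  comp f g := ⟨f.hom ≫ g.hom, fun σ => by
    rw [← Category.assoc, f.map_op, Category.assoc, g.map_op, ← Category.assoc]
    congr 1
    ext; simp⟩

@[ext]
lemma ext_hom {A B : V.Alg C} {f g : A ⟶ B} (h : f.hom = g.hom) : f = g := Hom.ext h

@[simp]
lemma id_hom (A : V.Alg C) : Hom.hom (𝟙 A) = 𝟙 A.carrier := rfl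

@[simp]
lemma comp_hom {A B D : V.Alg C} (f : A ⟶ B) (g : B ⟶ D) : (f ≫ g).hom = f.hom ≫ g.hom := rfl

lemma lift_op {A B : V.Alg C} (f : A ⟶ B) (σ : V.Op) {X : C}
    (a : Fin (V.arity σ) → (X ⟶ A.carrier)) :
    (Pi.lift a ≫ A.op σ) ≫ f.hom = Pi.lift (fun i => a i ≫ f.hom) ≫ B.op σ := by
  rw [Category.assoc, f.map_op, ← Category.assoc]
  congr 1
  ext; simp

variable (C V) in
/-- The terminal algebra. -/
def unit : V.Alg C where
  carrier := 𝟙_ C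
  op _ := toUnit _
  sat _ _ _ _ := toUnit_unique _ _

/-- The componentwise operations on a product. -/
def prodOp (A B : V.Alg C) (σ : V.Op) :
    power (A.carrier ⊗ B.carrier) (V.arity σ) ⟶ A.carrier ⊗ B.carrier :=
  lift (Limits.Pi.map (fun _ => fst _ _) ≫ A.op σ) (Limits.Pi.map (fun _ => snd _ _) ≫ B.op σ)

lemma eval_prodOp (A B : V.Alg C) {n : ℕ} (t : V.Term n) :
    eval (prodOp A B) t =
      lift (Limits.Pi.map (fun _ => fst _ _) ≫ eval A.op t) (Limits.Pi.map (fun _ => snd _ _) ≫ eval B.op t) := by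
  induction t with
  | var i => ext <;> simp [eval]
  | app σ ts ih =>
    simp only [eval, prodOp, comp_lift, ← Category.assoc]
    congr 2
    · ext j; simp [ih]
    · ext j; simp [ih]

/-- The product of two algebras. -/
def prod (A B : V.Alg C) : V.Alg C where
  carrier := A.carrier ⊗ B.carrier
  op := prodOp A B
  sat n s t h := by rw [eval_prodOp, eval_prodOp, A.sat n s t h, B.sat n s t h]

/-- The first projection. -/
def prodFst (A B : V.Alg C) : prod A B ⟶ A where
  hom := fst _ _
  map_op σ := by simp [prod, prodOp]

/-- The second projection. -/
def prodSnd (A B : V.Alg C) : prod A B ⟶ B where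
  hom := snd _ _
  map_op σ := by simp [prod, prodOp]

/-- The pairing of two homomorphisms. -/
def prodLift {X A B : V.Alg C} (f : X ⟶ A) (g : X ⟶ B) : X ⟶ prod A B where
  hom := lift f.hom g.hom
  map_op σ := by
    change X.op σ ≫ lift f.hom g.hom =
      Limits.Pi.map (fun _ => lift f.hom g.hom) ≫ prodOp A B σ
    simp only [prodOp, comp_lift, ← Category.assoc, f.map_op, g.map_op]
    congr 2
    · ext; simp
    · ext; simp

/-- The category of algebras has finite products, computed on underlying objects. -/
instance : CartesianMonoidalCategory (V.Alg C) :=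
  .ofChosenFiniteProducts
    ⟨asEmptyCone (unit C V), IsTerminal.ofUniqueHom (fun A => ⟨toUnit _, fun _ => toUnit_unique _ _⟩)
      (fun _ _ => ext_hom (toUnit_unique _ _))⟩
    (fun A B => ⟨BinaryFan.mk (prodFst A B) (prodSnd A B), BinaryFan.isLimitMk
      (fun s => prodLift s.fst s.snd)
      (fun s => ext_hom (lift_fst _ _)) (fun s => ext_hom (lift_snd _ _))
      (fun s m h1 h2 => ext_hom (by
        apply CartesianMonoidalCategory.hom_ext
        · exact (congrArg Hom.hom h1).trans (lift_fst _ _).symm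
        · exact (congrArg Hom.hom h2).trans (lift_snd _ _).symm))⟩)

instance : BraidedCategory (V.Alg C) := .ofCartesianMonoidalCategory

lemma tensor_carrier (A B : V.Alg C) : (A ⊗ B).carrier = A.carrier ⊗ B.carrier := rfl

lemma fst_hom (A B : V.Alg C) : (fst A B).hom = fst A.carrier B.carrier := rfl

lemma snd_hom (A B : V.Alg C) : (snd A B).hom = snd A.carrier B.carrier := rfl

lemma lift_hom {X A B : V.Alg C} (f : X ⟶ A) (g : X ⟶ B) :
    (lift f g).hom = lift f.hom g.hom := by
  apply CartesianMonoidalCategory.hom_ext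
  · exact (congrArg Hom.hom (lift_fst f g)).trans (lift_fst _ _).symm
  · exact (congrArg Hom.hom (lift_snd f g)).trans (lift_snd _ _).symm

lemma associator_hom (A B D : V.Alg C) :
    (α_ A B D).hom.hom = (α_ A.carrier B.carrier D.carrier).hom := by
  apply CartesianMonoidalCategory.hom_ext
  · exact (congrArg Hom.hom (associator_hom_fst A B D)).trans (associator_hom_fst _ _ _).symm
  · apply CartesianMonoidalCategory.hom_ext
    · exact (Category.assoc _ _ _).trans <|
        (congrArg Hom.hom (associator_hom_snd_fst A B D)).trans
        ((Category.assoc _ _ _).trans (associator_hom_snd_fst _ _ _)).symm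
    · exact (Category.assoc _ _ _).trans <|
        (congrArg Hom.hom (associator_hom_snd_snd A B D)).trans
        ((Category.assoc _ _ _).trans (associator_hom_snd_snd _ _ _)).symm

lemma leftUnitor_hom' (A : V.Alg C) : (λ_ A).hom.hom = (λ_ A.carrier).hom := by
  rw [leftUnitor_hom, leftUnitor_hom]; rfl

lemma rightUnitor_hom' (A : V.Alg C) : (ρ_ A).hom.hom = (ρ_ A.carrier).hom := by
  rw [rightUnitor_hom, rightUnitor_hom]; rfl

lemma braiding_hom' [BraidedCategory C] (A B : V.Alg C) :
    (β_ A B).hom.hom = (β_ A.carrier B.carrier).hom := by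
  apply CartesianMonoidalCategory.hom_ext
  · exact (congrArg Hom.hom (braiding_hom_fst A B)).trans (braiding_hom_fst _ _).symm
  · exact (congrArg Hom.hom (braiding_hom_snd A B)).trans (braiding_hom_snd _ _).symm

end Alg

end

end AlgVariety

/-! ## The category of algebraic relations -/

/-- The objects of the category `Rel_V(Q)`: algebras of the variety `V` in the topos `C`. -/
structure RelAlg {C : Type u} [Category.{v} C] [CartesianMonoidalCategory C] [HasFiniteLimits C]
    [MonoidalClosed C] [HasSubobjectClassifier C] (V : AlgVariety.{w}) (Q : InternalQuantale C) where
  /-- The algebra. -/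
  alg : V.Alg C

namespace RelAlg

noncomputable section

open InternalQuantale QRel

open scoped MonObj

variable {C : Type u} [Category.{v} C] [CartesianMonoidalCategory C] [BraidedCategory C]
  [HasFiniteLimits C] [MonoidalClosed C] [HasSubobjectClassifier C] {V : AlgVariety.{w}}
  {Q : InternalQuantale C} [IsCommMonObj Q.carrier]

/-- The relation `R` is algebraic if
`R (a₁, b₁) ⊗ … ⊗ R (aₙ, bₙ) ≤ R (σ (a₁, …, aₙ), σ (b₁, …, bₙ))` for every operation `σ`. -/
def IsAlgebraic (A B : V.Alg C) (R : A.carrier ⊗ B.carrier ⟶ Q.carrier) : Prop :=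
  ∀ (σ : V.Op) {X : C} (a : Fin (V.arity σ) → (X ⟶ A.carrier))
    (b : Fin (V.arity σ) → (X ⟶ B.carrier)),
    Q.Le (∏ i, app R (a i) (b i)) (app R (Pi.lift a ≫ A.op σ) (Pi.lift b ≫ B.op σ))

lemma isAlgebraic_graph {A B : V.Alg C} (f : A ⟶ B) : IsAlgebraic A B (graph Q f.hom) := by
  intro σ X a b
  rw [← one_mul (∏ i, _)]
  apply mul_prod_graph_le
  intro Z g hg
  have h := (graph_le f.hom (g ≫ Pi.lift a ≫ A.op σ) (g ≫ Pi.lift b ≫ B.op σ)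
    (app (graph Q f.hom) (g ≫ Pi.lift a ≫ A.op σ) (g ≫ Pi.lift b ≫ B.op σ))).1 (Le.refl _) (𝟙 Z)
  rw [comp_one', comp_app]
  simp only [Category.id_comp] at h
  apply h
  rw [Category.assoc, AlgVariety.Alg.lift_op, ← Category.assoc, ← Category.assoc]
  congr 1
  ext i
  simpa using hg i

lemma le_comp {A B D X : C} (R : A ⊗ B ⟶ Q.carrier) (S : B ⊗ D ⟶ Q.carrier) (a : X ⟶ A)
    (b : X ⟶ B) (d : X ⟶ D) : Q.Le (app R a b * app S b d) (app (comp R S) a d) := by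
  have := (comp_le R S a d (app (comp R S) a d)).1 (Le.refl _) (𝟙 X) b
  simpa using this

lemma mul_mono {X : C} {a b c d : X ⟶ Q.carrier} (h : Q.Le a b) (h' : Q.Le c d) :
    Q.Le (a * c) (b * d) := by
  refine (mul_le_mul_left' h' a).trans ?_
  rw [mul_comm a, mul_comm b]
  exact mul_le_mul_left' h d

lemma isAlgebraic_comp {A B D : V.Alg C} {R : A.carrier ⊗ B.carrier ⟶ Q.carrier}
    {S : B.carrier ⊗ D.carrier ⟶ Q.carrier} (hR : IsAlgebraic A B R) (hS : IsAlgebraic B D S) :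
    IsAlgebraic A D (comp R S) := by
  intro σ X a b
  rw [← one_mul (∏ i, _)]
  apply mul_prod_comp_le
  intro Z g y
  rw [comp_one', one_mul, Finset.prod_mul_distrib]
  refine (mul_mono (hR σ _ _) (hS σ _ _)).trans ((le_comp _ _ _ _ _).trans ?_)
  rw [comp_app, ← Category.assoc, ← Category.assoc]
  convert Le.refl _ using 4 <;> ext <;> simp

lemma isAlgebraic_converse {A B : V.Alg C} {R : A.carrier ⊗ B.carrier ⟶ Q.carrier}
    (hR : IsAlgebraic A B R) : IsAlgebraic B A (converse R) := by
  intro σ X a b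
  simp only [app_converse]
  exact hR σ b a

lemma isAlgebraic_tensor {A A' B B' : V.Alg C} {R : A.carrier ⊗ B.carrier ⟶ Q.carrier}
    {R' : A'.carrier ⊗ B'.carrier ⟶ Q.carrier} (hR : IsAlgebraic A B R)
    (hR' : IsAlgebraic A' B' R') : IsAlgebraic (A ⊗ A') (B ⊗ B') (tensor R R') := by
  intro σ X a b
  have e1 (A A' : V.Alg C) (a : Fin (V.arity σ) → (X ⟶ A.carrier ⊗ A'.carrier)) :
      (Pi.lift a ≫ (A ⊗ A').op σ) ≫ fst A.carrier A'.carrier =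
        Pi.lift (fun i => a i ≫ fst _ _) ≫ A.op σ := AlgVariety.Alg.lift_op (fst A A') σ a
  have e2 (A A' : V.Alg C) (a : Fin (V.arity σ) → (X ⟶ A.carrier ⊗ A'.carrier)) :
      (Pi.lift a ≫ (A ⊗ A').op σ) ≫ snd A.carrier A'.carrier =
        Pi.lift (fun i => a i ≫ snd _ _) ≫ A'.op σ := AlgVariety.Alg.lift_op (snd A A') σ a
  have e3 := (app_tensor R R' (Pi.lift a ≫ (A ⊗ A').op σ) (Pi.lift b ≫ (B ⊗ B').op σ)).trans
    (congrArg₂ (· * ·) (congrArg₂ (app R) (e1 A A' a) (e1 B B' b))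
      (congrArg₂ (app R') (e2 A A' a) (e2 B B' b)))
  have e4 : ∏ i, app (tensor R R') (a i) (b i) =
      (∏ i, app R (a i ≫ fst _ _) (b i ≫ fst _ _)) *
        ∏ i, app R' (a i ≫ snd _ _) (b i ≫ snd _ _) := by
    rw [← Finset.prod_mul_distrib]
    exact Finset.prod_congr rfl fun i _ => app_tensor R R' (a i) (b i)
  have := mul_mono (hR σ (fun i => a i ≫ fst _ _) (fun i => b i ≫ fst _ _))
    (hR' σ (fun i => a i ≫ snd _ _) (fun i => b i ≫ snd _ _))
  exact (e4 ▸ e3 ▸ this :)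

/-- The morphisms of `Rel_V(Q)`: algebraic `Q`-relations. -/
@[ext]
structure Hom (A B : RelAlg V Q) where
  /-- The underlying `Q`-relation. -/
  rel : A.alg.carrier ⊗ B.alg.carrier ⟶ Q.carrier
  isAlgebraic : IsAlgebraic A.alg B.alg rel

/-- The category `Rel_V(Q)`. The identity on `A` is `(a₁, a₂) ↦ ⋁ {k | a₁ = a₂}`. -/
instance : Category (RelAlg V Q) where
  Hom A B := Hom A B
  id A := ⟨graph Q (𝟙 A.alg.carrier), isAlgebraic_graph (𝟙 A.alg)⟩
  comp R S := ⟨comp R.rel S.rel, isAlgebraic_comp R.isAlgebraic S.isAlgebraic⟩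
  id_comp R := Hom.ext (id_comp' R.rel)
  comp_id R := Hom.ext (comp_id' R.rel)
  assoc R S T := Hom.ext (comp_assoc R.rel S.rel T.rel)

lemma ext_rel {A B : RelAlg V Q} {R S : A ⟶ B} (h : R.rel = S.rel) : R = S := Hom.ext h

lemma comp_rel {A B D : RelAlg V Q} (R : A ⟶ B) (S : B ⟶ D) :
    (R ≫ S).rel = comp R.rel S.rel := rfl

lemma id_rel (A : RelAlg V Q) : Hom.rel (𝟙 A) = graph Q (𝟙 A.alg.carrier) := rfl

variable (V Q) in
/-- The graph functor from algebras and homomorphisms to algebras and algebraic `Q`-relations. -/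
def graphFunctor : V.Alg C ⥤ RelAlg V Q where
  obj A := ⟨A⟩
  map f := ⟨graph Q f.hom, isAlgebraic_graph f⟩
  map_id _ := rfl
  map_comp f g := ext_rel (graph_comp_graph f.hom g.hom).symm

/-- The converse of an algebraic `Q`-relation. -/
def conv {A B : RelAlg V Q} (R : A ⟶ B) : B ⟶ A :=
  ⟨converse R.rel, isAlgebraic_converse R.isAlgebraic⟩

/-- The tensor product is the product of algebras on objects and the pointwise tensor on
relations; the coherence isomorphisms are the graphs of those of the finite product structure on
algebras. -/
instance : MonoidalCategoryStruct (RelAlg V Q) where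
  tensorObj A B := ⟨A.alg ⊗ B.alg⟩
  tensorUnit := ⟨𝟙_ (V.Alg C)⟩
  tensorHom R S := ⟨tensor R.rel S.rel, isAlgebraic_tensor R.isAlgebraic S.isAlgebraic⟩
  whiskerLeft A _ _ S := ⟨tensor (Hom.rel (𝟙 A)) S.rel,
    isAlgebraic_tensor (Hom.isAlgebraic (𝟙 A)) S.isAlgebraic⟩
  whiskerRight R B := ⟨tensor R.rel (Hom.rel (𝟙 B)),
    isAlgebraic_tensor R.isAlgebraic (Hom.isAlgebraic (𝟙 B))⟩
  associator A B D := (graphFunctor V Q).mapIso (α_ A.alg B.alg D.alg)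
  leftUnitor A := (graphFunctor V Q).mapIso (λ_ A.alg)
  rightUnitor A := (graphFunctor V Q).mapIso (ρ_ A.alg)

lemma graph_tensor {A A' B B' : V.Alg C} (f : A ⟶ B) (g : A' ⟶ B') :
    (graphFunctor V Q).map f ⊗ₘ (graphFunctor V Q).map g = (graphFunctor V Q).map (f ⊗ₘ g) := by
  apply ext_rel
  have e : (f ⊗ₘ g).hom = f.hom ⊗ₘ g.hom := by
    apply CartesianMonoidalCategory.hom_ext
    · exact (congrArg AlgVariety.Alg.Hom.hom (tensorHom_fst f g)).trans (tensorHom_fst _ _).symm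
    · exact (congrArg AlgVariety.Alg.Hom.hom (tensorHom_snd f g)).trans (tensorHom_snd _ _).symm
  change tensor (graph Q f.hom) (graph Q g.hom) = graph Q (f ⊗ₘ g).hom
  exact (tensor_graph _ _).trans (congrArg (graph Q) e.symm)


/-- `Rel_V(Q)` is a monoidal category. -/
instance : MonoidalCategory (RelAlg V Q) := .ofTensorHom
  (id_tensorHom_id := fun A B => (graph_tensor (𝟙 A.alg) (𝟙 B.alg)).trans (by simp; rfl))
  (id_tensorHom := fun _ _ _ _ => rfl)
  (tensorHom_id := fun _ _ => rfl)
  (tensorHom_comp_tensorHom := fun R R' S S' =>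
    ext_rel (tensor_comp_tensor R.rel R'.rel S.rel S'.rel))
  (associator_naturality := fun {A B D A' B' D'} R S T => ext_rel (by
    change comp _ (graph Q (α_ A'.alg B'.alg D'.alg).hom.hom) =
      comp (graph Q (α_ A.alg B.alg D.alg).hom.hom) _
    rw [AlgVariety.Alg.associator_hom, AlgVariety.Alg.associator_hom]
    exact associator_nat R.rel S.rel T.rel))
  (leftUnitor_naturality := fun {A B} R => ext_rel (by
    change comp _ (graph Q (λ_ B.alg).hom.hom) = comp (graph Q (λ_ A.alg).hom.hom) _
    rw [AlgVariety.Alg.leftUnitor_hom', AlgVariety.Alg.leftUnitor_hom']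
    exact leftUnitor_nat R.rel))
  (rightUnitor_naturality := fun {A B} R => ext_rel (by
    change comp _ (graph Q (ρ_ B.alg).hom.hom) = comp (graph Q (ρ_ A.alg).hom.hom) _
    rw [AlgVariety.Alg.rightUnitor_hom', AlgVariety.Alg.rightUnitor_hom']
    exact rightUnitor_nat R.rel))
  (pentagon := fun A B D E => by
    change ((graphFunctor V Q).map _ ⊗ₘ (graphFunctor V Q).map (𝟙 E.alg)) ≫
      (graphFunctor V Q).map _ ≫ ((graphFunctor V Q).map (𝟙 A.alg) ⊗ₘ (graphFunctor V Q).map _) =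
      (graphFunctor V Q).map _ ≫ (graphFunctor V Q).map _
    rw [graph_tensor, graph_tensor]
    have := congrArg (graphFunctor V Q).map (MonoidalCategory.pentagon A.alg B.alg D.alg E.alg)
    rw [← tensorHom_id, ← id_tensorHom] at this
    simp only [Functor.map_comp] at this
    exact this)
  (triangle := fun A B => by
    change (graphFunctor V Q).map _ ≫
      ((graphFunctor V Q).map (𝟙 A.alg) ⊗ₘ (graphFunctor V Q).map _) =
      ((graphFunctor V Q).map _ ⊗ₘ (graphFunctor V Q).map (𝟙 B.alg))
    rw [graph_tensor, graph_tensor]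
    have := congrArg (graphFunctor V Q).map (MonoidalCategory.triangle A.alg B.alg)
    rw [← tensorHom_id, ← id_tensorHom] at this
    simp only [Functor.map_comp] at this
    exact this)

lemma braiding_natural {A A' B B' : RelAlg V Q} (R : A ⟶ A') (S : B ⟶ B') :
    (R ⊗ₘ S) ≫ (graphFunctor V Q).map (β_ A'.alg B'.alg).hom =
      ((graphFunctor V Q).map (β_ A.alg B.alg).hom ≫ (S ⊗ₘ R) : A ⊗ B ⟶ B' ⊗ A') := ext_rel (by
  change comp _ (graph Q (β_ A'.alg B'.alg).hom.hom) = comp (graph Q (β_ A.alg B.alg).hom.hom) _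
  rw [AlgVariety.Alg.braiding_hom', AlgVariety.Alg.braiding_hom']
  exact braiding_nat R.rel S.rel)

/-- `Rel_V(Q)` is a symmetric monoidal category, the symmetry being the graph of the symmetry of
the finite product structure on algebras. -/
instance : SymmetricCategory (RelAlg V Q) where
  braiding A B := (graphFunctor V Q).mapIso (β_ A.alg B.alg)
  braiding_naturality_right A _ _ S := by
    rw [← id_tensorHom, ← tensorHom_id]
    exact braiding_natural (𝟙 A) S
  braiding_naturality_left R B := by
    rw [← id_tensorHom, ← tensorHom_id]
    exact braiding_natural R (𝟙 B)
  hexagon_forward A B D := by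
    rw [← tensorHom_id, ← id_tensorHom]
    change (graphFunctor V Q).map _ ≫ (graphFunctor V Q).map _ ≫ (graphFunctor V Q).map _ =
      ((graphFunctor V Q).map _ ⊗ₘ (graphFunctor V Q).map (𝟙 D.alg)) ≫ (graphFunctor V Q).map _ ≫
      ((graphFunctor V Q).map (𝟙 B.alg) ⊗ₘ (graphFunctor V Q).map _)
    rw [graph_tensor, graph_tensor]
    have := congrArg (graphFunctor V Q).map
      (BraidedCategory.hexagon_forward A.alg B.alg D.alg)
    rw [← tensorHom_id, ← id_tensorHom] at this
    simp only [Functor.map_comp] at this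
    exact this
  hexagon_reverse A B D := by
    rw [← tensorHom_id, ← id_tensorHom]
    change (graphFunctor V Q).map _ ≫ (graphFunctor V Q).map _ ≫ (graphFunctor V Q).map _ =
      ((graphFunctor V Q).map (𝟙 A.alg) ⊗ₘ (graphFunctor V Q).map _) ≫ (graphFunctor V Q).map _ ≫
      ((graphFunctor V Q).map _ ⊗ₘ (graphFunctor V Q).map (𝟙 B.alg))
    rw [graph_tensor, graph_tensor]
    have := congrArg (graphFunctor V Q).map
      (BraidedCategory.hexagon_reverse A.alg B.alg D.alg)
    rw [← tensorHom_id, ← id_tensorHom] at this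
    simp only [Functor.map_comp] at this
    exact this
  symmetry A B := by
    change (graphFunctor V Q).map _ ≫ (graphFunctor V Q).map _ = _
    rw [← Functor.map_comp, SymmetricCategory.symmetry]
    exact (graphFunctor V Q).map_id _

end

end RelAlg

/-! ## Hypergraph categories -/

open scoped MonObj ComonObj in
/-- A hypergraph category: a symmetric monoidal category with a chosen special commutative
Frobenius algebra structure on every object, coherent with the tensor product. -/
class HypergraphCategory (D : Type u) [Category.{v} D] [MonoidalCategory D]
    [SymmetricCategory D] where
  /-- The monoid structure on an object. -/
  mon (A : D) : MonObj A
  /-- The comonoid structure on an object. -/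
  comon (A : D) : ComonObj A
  mon_comm (A : D) : IsCommMonObj A
  comon_comm (A : D) : IsCommComonObj A
  comul_tensor (A B : D) : (comon (A ⊗ B)).comul = (Δ[A] ⊗ₘ Δ[B]) ≫ tensorμ A A B B
  counit_tensor (A B : D) : (comon (A ⊗ B)).counit = (ε[A] ⊗ₘ ε[B]) ≫ (λ_ (𝟙_ D)).hom
  mul_tensor (A B : D) : (mon (A ⊗ B)).mul = tensorμ A B A B ≫ (μ[A] ⊗ₘ μ[B])
  one_tensor (A B : D) : (mon (A ⊗ B)).one = (λ_ (𝟙_ D)).inv ≫ (η[A] ⊗ₘ η[B])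
  frobenius_left (A : D) : (A ◁ Δ[A]) ≫ (α_ A A A).inv ≫ (μ[A] ▷ A) = μ[A] ≫ Δ[A]
  frobenius_right (A : D) : (Δ[A] ▷ A) ≫ (α_ A A A).hom ≫ (A ◁ μ[A]) = μ[A] ≫ Δ[A]
  special (A : D) : Δ[A] ≫ μ[A] = 𝟙 A

/-! Two facts carry most of the theorem. The graph functor from algebras to `RelAlg V Q` preserves
the whole symmetric monoidal structure, and the converse is an identity-on-objects involution that
reverses composition, commutes with the tensor, and sends the graph of an isomorphism to the graph
of its inverse.

In a category with finite products the diagonal and the terminal map make every object a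
cocommutative comonoid, coherently with products. Graphs carry this structure to `RelAlg V Q`, and
converses turn it into a commutative monoid structure with the dual laws. No computation with truth
values is needed for this.

Only the laws mixing graphs with converses require more. The Frobenius law is the Beck–Chevalley
condition (`converse_graph_comp_graph`) for the pullback of `(x, y) ↦ (x, x, y)` along `(x, y) ↦ (x,
y, y)`, which is `A` with the diagonal as both projections; the second Frobenius law is the converse
of the first. The special law holds because the diagonal is monic (`graph_comp_converse_graph`).

Both facts are proved by comparing upper bounds. A join is bounded by `c` exactly when each of its
terms is, at every stage of definition, so generalized elements suffice. Since a morphism of `RelAlg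
V Q` is determined by its underlying relation, algebraicity plays no part in verifying the
equations. -/

/-! ### Converses and graphs of `Q`-valued relations in the topos -/

namespace QRel

noncomputable section

open InternalQuantale

open scoped MonObj

variable {C : Type u} [Category.{v} C] [CartesianMonoidalCategory C] [BraidedCategory C]
  [HasFiniteLimits C] [MonoidalClosed C] [HasSubobjectClassifier C] {Q : InternalQuantale C}
  [IsCommMonObj Q.carrier]

/-- Reversing a composite exchanges the two factors under the join, so commutativity of the quantale
is what makes this hold. -/
lemma converse_comp {A B D : C} (R : A ⊗ B ⟶ Q.carrier) (S : B ⊗ D ⟶ Q.carrier) :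
    converse (comp R S) = comp (converse S) (converse R) :=
  ext' fun a b => eq_of_le_iff fun c => by
    simp only [app_converse, comp_le]
    exact ⟨fun h _ g y => by rw [mul_comm]; exact h g y,
      fun h _ g y => by rw [mul_comm]; exact h g y⟩

lemma converse_converse {A B : C} (R : A ⊗ B ⟶ Q.carrier) : converse (converse R) = R :=
  ext' fun a b => by rw [app_converse, app_converse]

lemma converse_tensor {A A' B B' : C} (R : A ⊗ B ⟶ Q.carrier) (R' : A' ⊗ B' ⟶ Q.carrier) :
    converse (tensor R R') = tensor (converse R) (converse R') :=
  ext' fun a b => by simp only [app_converse, app_tensor]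

/-- The Beck–Chevalley condition for weak pullback squares. -/
lemma converse_graph_comp_graph {P A B D : C} (p : P ⟶ A) (q : P ⟶ B) (f : A ⟶ D) (h : B ⟶ D)
    (w : p ≫ f = q ≫ h)
    (hw : ∀ {X : C} (a : X ⟶ A) (b : X ⟶ B), a ≫ f = b ≫ h →
      ∃ y : X ⟶ P, y ≫ p = a ∧ y ≫ q = b) :
    comp (converse (graph Q p)) (graph Q q) = comp (graph Q f) (converse (graph Q h)) := by
  refine ext' fun {X} a b => eq_of_le_iff fun c => ?_
  -- The right-hand side collapses to the graph of `f` evaluated at `(a, b ≫ h)`. Its upper bounds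
  -- are the `c` that dominate the unit wherever `f a = h b`. The left-hand side remains a join over
  -- `y : P`.
  rw [app_comp_converse_graph, graph_le, comp_le]
  constructor
  · intro H Z g hg
    -- At this `y` both factors of the term dominate the unit. Existence of `y` is enough, because a
    -- join does not count how often a value occurs.
    obtain ⟨y, hp, hq⟩ := hw (g ≫ a) (g ≫ b) (by simpa using hg)
    have := H g y
    rw [app_converse, mul_graph_le] at this
    have := this (𝟙 Z) (by simp [hq])
    simp only [Category.id_comp, graph_le] at this
    simpa using this (𝟙 Z) (by simp [hp])
  · intro H Z g y
    rw [app_converse, mul_graph_le]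
    intro W k hk
    rw [comp_app, graph_le]
    intro U l hl
    -- On the stage where `q y = b` (reached by `k`) and `p y = a` (reached by `l`), commutativity
    -- of the square gives `f a = h b`.
    have := H (l ≫ k ≫ g) (by
      simp only [Category.assoc] at hl hk ⊢
      rw [← reassoc_of% hl, w, reassoc_of% hk])
    simpa using this

/-- The Frobenius law on underlying relations. The square is a pullback: `(x, x, y) = (x', y', y')`
forces all four variables to coincide. -/
lemma converse_graph_diag_comp_graph_diag (A : C) :
    comp (converse (graph Q (lift (𝟙 A) (𝟙 A)))) (graph Q (lift (𝟙 A) (𝟙 A))) =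
      comp (graph Q (lift (𝟙 A) (𝟙 A) ▷ A ≫ (α_ A A A).hom))
        (converse (graph Q (A ◁ lift (𝟙 A) (𝟙 A)))) := by
  apply converse_graph_comp_graph
  · ext <;> simp
  · intro X a b h
    have h₁ := h =≫ fst _ _
    have h₂ := h =≫ (snd _ _ ≫ fst _ _)
    have h₃ := h =≫ (snd _ _ ≫ snd _ _)
    simp only [Category.assoc, associator_hom_fst, associator_hom_snd_fst, associator_hom_snd_snd,
      whiskerRight_fst_assoc, whiskerRight_snd, whiskerLeft_fst,
      whiskerLeft_snd_assoc, lift_fst, lift_snd, Category.comp_id] at h₁ h₂ h₃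
    exact ⟨a ≫ fst A A, by ext <;> simp [h₂, h₃], by ext <;> simp [h₁, ← h₂]⟩

/-- The composite takes the value `⋁ {k | f a = f b}` at `(a, b)`, and cancelling the monomorphism
turns the condition into `a = b`. -/
lemma graph_comp_converse_graph {A B : C} (f : A ⟶ B) [Mono f] :
    comp (graph Q f) (converse (graph Q f)) = graph Q (𝟙 A) := by
  refine ext' fun a b => eq_of_le_iff fun c => ?_
  simp only [app_comp_converse_graph, graph_le, ← Category.assoc, cancel_mono, Category.comp_id]

end

end QRel

/-! ### Converses and graphs as operations on algebraic relations -/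

namespace RelAlg

noncomputable section

open InternalQuantale QRel

open scoped MonObj

variable {C : Type u} [Category.{v} C] [CartesianMonoidalCategory C] [BraidedCategory C]
  [HasFiniteLimits C] [MonoidalClosed C] [HasSubobjectClassifier C] {V : AlgVariety.{w}}
  {Q : InternalQuantale C} [IsCommMonObj Q.carrier]

lemma conv_comp {A B D : RelAlg V Q} (R : A ⟶ B) (S : B ⟶ D) :
    conv (R ≫ S) = conv S ≫ conv R := ext_rel (converse_comp R.rel S.rel)

lemma conv_conv {A B : RelAlg V Q} (R : A ⟶ B) : conv (conv R) = R :=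
  ext_rel (converse_converse R.rel)

lemma conv_tensorHom {A A' B B' : RelAlg V Q} (R : A ⟶ B) (S : A' ⟶ B') :
    conv (R ⊗ₘ S) = conv R ⊗ₘ conv S := ext_rel (converse_tensor R.rel S.rel)

lemma conv_map_hom {A B : V.Alg C} (e : A ≅ B) :
    conv ((graphFunctor V Q).map e.hom) = (graphFunctor V Q).map e.inv :=
  -- `graph_iso` is applied to the inverse of `e` on carriers, because it writes the graph of a
  -- forward map as a converse.
  ext_rel (graph_iso (Q := Q) (A := B.carrier) (B := A.carrier)
    ⟨e.inv.hom, e.hom.hom, congrArg AlgVariety.Alg.Hom.hom e.inv_hom_id,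
      congrArg AlgVariety.Alg.Hom.hom e.hom_inv_id⟩).symm

lemma conv_id (A : RelAlg V Q) : conv (𝟙 A) = 𝟙 A := conv_map_hom (Iso.refl A.alg)

lemma conv_whiskerRight {A B : RelAlg V Q} (R : A ⟶ B) (D : RelAlg V Q) :
    conv (R ▷ D) = conv R ▷ D := by
  rw [← tensorHom_id, conv_tensorHom, conv_id, tensorHom_id]

lemma conv_whiskerLeft {A B : RelAlg V Q} (R : A ⟶ B) (D : RelAlg V Q) :
    conv (D ◁ R) = D ◁ conv R := by
  rw [← id_tensorHom, conv_tensorHom, conv_id, id_tensorHom]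

/-- The graph of a homomorphism between the algebras underlying two objects. -/
def ofHom {A B : RelAlg V Q} (f : A.alg ⟶ B.alg) : A ⟶ B := (graphFunctor V Q).map f

/-- With the next three lemmas, this merges composites, tensors and whiskerings of graphs into the
graph of a single homomorphism, which reduces an identity of relations to one of algebra
homomorphisms. -/
lemma ofHom_comp {A B D : RelAlg V Q} (f : A.alg ⟶ B.alg) (g : B.alg ⟶ D.alg) :
    (ofHom f : A ⟶ B) ≫ (ofHom g : B ⟶ D) = ofHom (f ≫ g) :=
  ((graphFunctor V Q).map_comp f g).symm

lemma ofHom_tensorHom {A A' B B' : RelAlg V Q} (f : A.alg ⟶ B.alg) (g : A'.alg ⟶ B'.alg) :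
    (ofHom f : A ⟶ B) ⊗ₘ (ofHom g : A' ⟶ B') = ofHom (A := A ⊗ A') (B := B ⊗ B') (f ⊗ₘ g) :=
  graph_tensor f g

lemma ofHom_whiskerRight {A B : RelAlg V Q} (f : A.alg ⟶ B.alg) (D : RelAlg V Q) :
    (ofHom f : A ⟶ B) ▷ D = ofHom (A := A ⊗ D) (B := B ⊗ D) (f ▷ D.alg) := by
  rw [← tensorHom_id, ← tensorHom_id]
  exact ofHom_tensorHom f (𝟙 D.alg)

lemma ofHom_whiskerLeft {A B : RelAlg V Q} (f : A.alg ⟶ B.alg) (D : RelAlg V Q) :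
    D ◁ (ofHom f : A ⟶ B) = ofHom (A := D ⊗ A) (B := D ⊗ B) (D.alg ◁ f) := by
  rw [← id_tensorHom, ← id_tensorHom]
  exact ofHom_tensorHom (𝟙 D.alg) f

/-! ### Converses of the coherence isomorphisms -/

lemma conv_associator_hom (A B D : RelAlg V Q) : conv (α_ A B D).hom = (α_ A B D).inv :=
  conv_map_hom (α_ A.alg B.alg D.alg)

lemma conv_associator_inv (A B D : RelAlg V Q) : conv (α_ A B D).inv = (α_ A B D).hom :=
  conv_map_hom (α_ A.alg B.alg D.alg).symm

lemma conv_leftUnitor_hom (A : RelAlg V Q) : conv (λ_ A).hom = (λ_ A).inv :=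
  conv_map_hom (λ_ A.alg)

lemma conv_leftUnitor_inv (A : RelAlg V Q) : conv (λ_ A).inv = (λ_ A).hom :=
  conv_map_hom (λ_ A.alg).symm

lemma conv_rightUnitor_inv (A : RelAlg V Q) : conv (ρ_ A).inv = (ρ_ A).hom :=
  conv_map_hom (ρ_ A.alg).symm

lemma conv_braiding_hom (A B : RelAlg V Q) : conv (β_ A B).hom = (β_ B A).hom :=
  (conv_map_hom (β_ A.alg B.alg)).trans (congrArg (graphFunctor V Q).map
    (SymmetricCategory.braiding_swap_eq_inv_braiding A.alg B.alg).symm)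

/-- The interchange is a braiding conjugated by associators. Reversing this string and inverting
each factor gives a string of the same shape, with the two middle objects exchanged. -/
lemma conv_tensorμ (A₁ A₂ B₁ B₂ : RelAlg V Q) :
    conv (tensorμ A₁ A₂ B₁ B₂) = tensorμ A₁ B₁ A₂ B₂ := by
  simp only [tensorμ, conv_comp, conv_whiskerLeft, conv_whiskerRight, conv_associator_hom,
    conv_associator_inv, conv_braiding_hom, Category.assoc]

/-- The interchange is built from associators and a braiding, each of which is by definition the
graph of its counterpart for algebras. -/
lemma tensorμ_eq_ofHom (A₁ A₂ B₁ B₂ : RelAlg V Q) :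
    tensorμ A₁ A₂ B₁ B₂ = ofHom (A := (A₁ ⊗ A₂) ⊗ (B₁ ⊗ B₂)) (B := (A₁ ⊗ B₁) ⊗ (A₂ ⊗ B₂))
      (tensorμ A₁.alg A₂.alg B₁.alg B₂.alg) := by
  change _ = (graphFunctor V Q).map _
  simp only [tensorμ, Functor.map_comp, ← id_tensorHom, ← tensorHom_id, ← graph_tensor]
  rfl

/-- The counit of `A`, the graph of the terminal map. -/
def counit (A : RelAlg V Q) : A ⟶ 𝟙_ (RelAlg V Q) :=
  ofHom (B := 𝟙_ (RelAlg V Q)) (toUnit A.alg)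

/-- The comultiplication of `A`, the graph of the diagonal. -/
def comul (A : RelAlg V Q) : A ⟶ A ⊗ A := ofHom (B := A ⊗ A) (lift (𝟙 A.alg) (𝟙 A.alg))

/-! ### Comonoid laws and their coherence with the tensor product -/

/-- As in the other comonoid laws below, every arrow is a graph, so the law is the image of the
corresponding one for diagonals of algebras, which is checked on projections. -/
lemma counit_comul (A : RelAlg V Q) : comul A ≫ counit A ▷ A = (λ_ A).inv := by
  rw [counit, comul, ofHom_whiskerRight, ofHom_comp]
  refine congrArg (graphFunctor V Q).map (?_ : lift (𝟙 A.alg) (𝟙 A.alg) ≫ toUnit A.alg ▷ A.alg =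
    (λ_ A.alg).inv)
  ext1 <;> simp

lemma comul_counit (A : RelAlg V Q) : comul A ≫ A ◁ counit A = (ρ_ A).inv := by
  rw [counit, comul, ofHom_whiskerLeft, ofHom_comp]
  refine congrArg (graphFunctor V Q).map (?_ : lift (𝟙 A.alg) (𝟙 A.alg) ≫ A.alg ◁ toUnit A.alg =
    (ρ_ A.alg).inv)
  ext1 <;> simp

lemma associator_hom_eq_ofHom (A B D : RelAlg V Q) :
    (α_ A B D).hom = ofHom (A := (A ⊗ B) ⊗ D) (B := A ⊗ (B ⊗ D)) (α_ A.alg B.alg D.alg).hom := rfl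

lemma comul_assoc (A : RelAlg V Q) :
    comul A ≫ A ◁ comul A = comul A ≫ comul A ▷ A ≫ (α_ A A A).hom := by
  rw [comul, ofHom_whiskerLeft, ofHom_whiskerRight, associator_hom_eq_ofHom]
  simp only [ofHom_comp]
  refine congrArg (graphFunctor V Q).map (?_ : lift (𝟙 A.alg) (𝟙 A.alg) ≫
    A.alg ◁ lift (𝟙 A.alg) (𝟙 A.alg) = lift (𝟙 A.alg) (𝟙 A.alg) ≫
      lift (𝟙 A.alg) (𝟙 A.alg) ▷ A.alg ≫ (α_ A.alg A.alg A.alg).hom)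
  ext1 <;> [skip; ext1] <;> simp

lemma comul_comm (A : RelAlg V Q) : comul A ≫ (β_ A A).hom = comul A := by
  refine (ofHom_comp (B := A ⊗ A) (D := A ⊗ A) _ (β_ A.alg A.alg).hom).trans
    (congrArg (graphFunctor V Q).map
      (?_ : lift (𝟙 A.alg) (𝟙 A.alg) ≫ (β_ A.alg A.alg).hom = lift (𝟙 A.alg) (𝟙 A.alg)))
  ext1 <;> simp

lemma comul_tensor (A B : RelAlg V Q) :
    comul (A ⊗ B) = (comul A ⊗ₘ comul B) ≫ tensorμ A A B B := by
  rw [tensorμ_eq_ofHom]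
  simp only [comul, ofHom_tensorHom, ofHom_comp]
  refine congrArg (graphFunctor V Q).map (?_ : lift (𝟙 (A.alg ⊗ B.alg)) (𝟙 (A.alg ⊗ B.alg)) =
    (lift (𝟙 A.alg) (𝟙 A.alg) ⊗ₘ lift (𝟙 B.alg) (𝟙 B.alg)) ≫ tensorμ A.alg A.alg B.alg B.alg)
  ext1 <;> ext1 <;> simp [tensorμ]

lemma counit_tensor (A B : RelAlg V Q) :
    counit (A ⊗ B) = (counit A ⊗ₘ counit B) ≫ (λ_ (𝟙_ (RelAlg V Q))).hom := by
  rw [counit, counit, counit, ofHom_tensorHom]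
  -- Both sides are graphs of homomorphisms into the terminal algebra.
  exact (congrArg (graphFunctor V Q).map (toUnit_unique _ _)).trans
    ((graphFunctor V Q).map_comp _ (λ_ (𝟙_ (V.Alg C))).hom)

/-! ### The Frobenius and special laws -/

/-- The Frobenius law mixes graphs with converses, so it is not the image of an identity between
homomorphisms and is checked on underlying relations. This lemma and the next identify the carrier
maps involved. -/
lemma whiskerLeft_hom (A : V.Alg C) {B D : V.Alg C} (f : B ⟶ D) :
    (A ◁ f).hom = A.carrier ◁ f.hom := by
  apply CartesianMonoidalCategory.hom_ext
  · exact (congrArg AlgVariety.Alg.Hom.hom (whiskerLeft_fst A f)).trans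
      (whiskerLeft_fst _ _).symm
  · exact (congrArg AlgVariety.Alg.Hom.hom (whiskerLeft_snd A f)).trans
      (whiskerLeft_snd _ _).symm

lemma whiskerRight_hom {A B : V.Alg C} (f : A ⟶ B) (D : V.Alg C) :
    (f ▷ D).hom = f.hom ▷ D.carrier := by
  apply CartesianMonoidalCategory.hom_ext
  · exact (congrArg AlgVariety.Alg.Hom.hom (whiskerRight_fst f D)).trans
      (whiskerRight_fst _ _).symm
  · exact (congrArg AlgVariety.Alg.Hom.hom (whiskerRight_snd f D)).trans
      (whiskerRight_snd _ _).symm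

lemma conv_comul_comp_comul_right (A : RelAlg V Q) :
    comul A ▷ A ≫ (α_ A A A).hom ≫ A ◁ conv (comul A) = conv (comul A) ≫ comul A := by
  -- This brings the left side into the form of a graph followed by the converse of a graph, as in
  -- `converse_graph_diag_comp_graph_diag`.
  rw [← conv_whiskerLeft, ← Category.assoc, associator_hom_eq_ofHom, comul, ofHom_whiskerRight,
    ofHom_whiskerLeft, ofHom_comp]
  have e₁ : (lift (𝟙 A.alg) (𝟙 A.alg)).hom = lift (𝟙 A.alg.carrier) (𝟙 A.alg.carrier) :=
    AlgVariety.Alg.lift_hom _ _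
  have e₂ : (lift (𝟙 A.alg) (𝟙 A.alg) ▷ A.alg ≫ (α_ A.alg A.alg A.alg).hom).hom =
      lift (𝟙 A.alg.carrier) (𝟙 A.alg.carrier) ▷ A.alg.carrier ≫ (α_ _ _ _).hom :=
    congrArg₂ (· ≫ ·) ((whiskerRight_hom _ _).trans (congrArg (· ▷ A.alg.carrier) e₁))
      (AlgVariety.Alg.associator_hom _ _ _)
  have e₃ : (A.alg ◁ lift (𝟙 A.alg) (𝟙 A.alg)).hom =
      A.alg.carrier ◁ lift (𝟙 A.alg.carrier) (𝟙 A.alg.carrier) :=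
    (whiskerLeft_hom _ _).trans (congrArg (A.alg.carrier ◁ ·) e₁)
  exact ext_rel <|
    (congrArg₂ comp (congrArg (graph Q) e₂) (congrArg (fun t => converse (graph Q t)) e₃)).trans <|
    (converse_graph_diag_comp_graph_diag A.alg.carrier).symm.trans
    (congrArg₂ comp (congrArg (fun t => converse (graph Q t)) e₁) (congrArg (graph Q) e₁)).symm

/-- This is the converse of the preceding law, whose right-hand side is its own converse. -/
lemma conv_comul_comp_comul_left (A : RelAlg V Q) :
    A ◁ comul A ≫ (α_ A A A).inv ≫ conv (comul A) ▷ A = conv (comul A) ≫ comul A := by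
  have := congrArg conv (conv_comul_comp_comul_right A)
  simpa only [conv_comp, conv_whiskerLeft, conv_whiskerRight, conv_conv, conv_associator_hom,
    Category.assoc] using this

lemma comul_comp_conv_comul (A : RelAlg V Q) : comul A ≫ conv (comul A) = 𝟙 A := by
  have e : (lift (𝟙 A.alg) (𝟙 A.alg)).hom = lift (𝟙 A.alg.carrier) (𝟙 A.alg.carrier) :=
    AlgVariety.Alg.lift_hom _ _
  exact ext_rel <| (congrArg (fun t => comp (graph Q t) (converse (graph Q t))) e).trans
    (graph_comp_converse_graph (lift (𝟙 A.alg.carrier) (𝟙 A.alg.carrier)))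

/-- The comonoid structure on `A`. -/
instance (A : RelAlg V Q) : ComonObj A where
  counit := counit A
  comul := comul A
  counit_comul := counit_comul A
  comul_counit := comul_counit A
  comul_assoc := comul_assoc A

/-- The monoid structure on `A`, converse to the comonoid structure. -/
instance (A : RelAlg V Q) : MonObj A where
  one := conv (counit A)
  mul := conv (comul A)
  -- Each monoid law is the converse of the matching comonoid law.
  one_mul := by rw [← conv_whiskerRight, ← conv_comp, counit_comul, conv_leftUnitor_inv]
  mul_one := by rw [← conv_whiskerLeft, ← conv_comp, comul_counit, conv_rightUnitor_inv]
  mul_assoc := by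
    -- The associator in `comul_assoc` becomes its inverse under the converse and cancels against
    -- the one in the monoid law.
    rw [← conv_whiskerLeft, ← conv_whiskerRight, ← conv_comp, ← conv_comp, comul_assoc,
      conv_comp, conv_comp, conv_comp, conv_associator_hom]
    simp

instance (A : RelAlg V Q) : IsCommComonObj A := ⟨comul_comm A⟩

instance (A : RelAlg V Q) : IsCommMonObj A := ⟨by
  change (β_ A A).hom ≫ conv (comul A) = conv (comul A)
  rw [← conv_braiding_hom, ← conv_comp, comul_comm]⟩

variable (V Q) in
/-- The special commutative Frobenius structures of `Rel_V(Q)`. -/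
instance hypergraph : HypergraphCategory (RelAlg V Q) where
  mon A := inferInstance
  comon A := inferInstance
  mon_comm A := inferInstance
  comon_comm A := inferInstance
  comul_tensor := comul_tensor
  counit_tensor := counit_tensor
  mul_tensor A B := by
    change conv (comul (A ⊗ B)) = tensorμ A B A B ≫ (conv (comul A) ⊗ₘ conv (comul B))
    -- The interchange in `comul_tensor` has arguments `A A B B`; its converse has `A B A B`, as the
    -- monoid side requires.
    rw [comul_tensor, conv_comp, conv_tensorHom, conv_tensorμ]
  one_tensor A B := by
    change conv (counit (A ⊗ B)) = (λ_ (𝟙_ (RelAlg V Q))).inv ≫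
      (conv (counit A) ⊗ₘ conv (counit B))
    rw [counit_tensor, conv_comp, conv_tensorHom, conv_leftUnitor_hom]
  frobenius_left := conv_comul_comp_comul_left
  frobenius_right := conv_comul_comp_comul_right
  special := comul_comp_conv_comul

end

end RelAlg

/-- The category of algebras and algebraic `Q`-relations is a hypergraph category, whose comonoids
are the graphs of the terminal and diagonal maps and whose monoids are the converses of these. -/
theorem mainTheorem1 {C : Type u} [Category.{v} C] [CartesianMonoidalCategory C]
    [BraidedCategory C] [HasFiniteLimits C] [MonoidalClosed C] [HasSubobjectClassifier C]
    (V : AlgVariety.{w}) (Q : InternalQuantale C) [IsCommMonObj Q.carrier] :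
    ∃ H : HypergraphCategory (RelAlg V Q), ∀ A : RelAlg V Q,
      (H.comon A).counit = (RelAlg.graphFunctor V Q).map (toUnit A.alg) ∧
      (H.comon A).comul = (RelAlg.graphFunctor V Q).map (lift (𝟙 A.alg) (𝟙 A.alg)) ∧
      (H.mon A).one = RelAlg.conv ((RelAlg.graphFunctor V Q).map (toUnit A.alg)) ∧
      (H.mon A).mul = RelAlg.conv ((RelAlg.graphFunctor V Q).map (lift (𝟙 A.alg) (𝟙 A.alg))) :=
  ⟨RelAlg.hypergraph V Q, fun _ => ⟨rfl, rfl, rfl, rfl⟩⟩
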